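/- **Logic.** Let $\Gamma$ be a sorted first-order signature with finitely many sorts (at least one), function symbols, $\mathbf U$-operators and $\mathbf I$-operators. Formulae of $\mathrm{LTL}^{\mathrm{FO}}$ are the well-sorted expressions $$\varphi ::= p(\vec t)\mid r(\vec t)\mid \neg\varphi\mid\varphi\wedge\varphi\mid \mathsf X\varphi\mid\varphi\,\mathsf U\,\varphi\mid\forall(x_1,\dots,x_n):p.\ \varphi$$ with $p\in\mathbf U$, $r\in\mathbf I$, terms $\vec t$, and pairwise distinct variables $x_i$ whose sorts are those in the arity of $p$. Fix non-empty countable domains for the sorts and interpretations of the function symbols. A letter $(\mathfrak A,\sigma)$ consists of a structure $\mathfrak A$ with these domains and functions and arbitrary relations $r^{\mathfrak A}$ ($r\in\mathbf I$), and a finite set $\sigma$ of actions $(p,\vec d)$, where $p\in\mathbf U$ and $\vec d$ is a tuple of domain elements that fits the arity of $p$. A (finite or infinite) temporal structure $(\overline{\mathfrak A},w)$ is a sequence of letters $(\mathfrak A_i,w_i)$. For infinite ones, $(\overline{\mathfrak A},w,v,i)\models\varphi$ is defined as usual for first-order atoms and LTL operators, where $p(\vec t)$ holds at $i$ iff $(p,\vec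 t^{\,v})\in w_i$, and $\forall\vec x:p.\,\psi$ holds at $i$ under the valuation $v$ iff $\psi$ holds at $i$ under $v\cup\{\vec x\mapsto\vec d\}$ for all $(p,\vec d)\in w_i$. $\mathcal L(\varphi,v)$ is the set of infinite temporal structures that satisfy $\varphi$ at position $0$ under $v$. A finite temporal structure is a good (bad) prefix of $\varphi$ under $v$ if all (none) of its infinite continuations belong to $\mathcal L(\varphi,v)$. If $\varphi$ is a sentence, $v$ plays no role. **Automata.** The depth of $\varphi$ is its quantifier depth. Let $\mathrm{sf}(\varphi)$ be the set of subformulae of $\varphi$, where quantified formulae are not decomposed, and let $\mathrm{cl}(\varphi)$ be its closure under negation (identifying $\neg\neg\psi$ with $\psi$). The automaton $\mathcal A_{\varphi,v}$ has as states the sets $q\subseteq\mathrm{cl}(\varphi)$ such that: for every $\psi\in\mathrm{cl}(\varphi)$ exactly one of $\psi,\neg\psi$ is in $q$; a conjunction in $\mathrm{cl}(\varphi)$ is in $q$ iff both conjuncts are; for $\psi\,\mathsf U\,\psi'\in\mathrm{cl}(\varphi)$, if it is in $q$ then $\psi'\in q$ or $\psi\in q$, and if it is not in $q$ then $\psi'\notin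 q$. Initial states are those that contain $\varphi$. There is a transition from $q$ to $q'$ under $(\mathfrak A,\sigma)$ iff all atoms and negated atoms in $q$ are true in $(\mathfrak A,\sigma)$ under $v$; for all $\mathsf X\psi\in\mathrm{cl}(\varphi)$, $\mathsf X\psi\in q\Leftrightarrow\psi\in q'$; and for all $\psi\,\mathsf U\,\psi'\in\mathrm{cl}(\varphi)$, $\psi\,\mathsf U\,\psi'\in q\Leftrightarrow\psi'\in q$ or ($\psi\in q$ and $\psi\,\mathsf U\,\psi'\in q'$). If $\varphi$ has positive depth, the spawning function is the positive Boolean combination of automata of smaller depth $$\delta_\downarrow(q,(\mathfrak A,\sigma))=\bigwedge_{\forall\vec x:p.\psi\in q}\ \bigwedge_{(p,\vec d)\in\sigma}\mathcal A_{\psi,v\cup\{\vec x\mapsto\vec d\}}\ \wedge\bigwedge_{\neg\forall\vec x:p.\psi\in q}\ \bigvee_{(p,\vec d)\in\sigma}\mathcal A_{\neg\psi,v\cup\{\vec x\mapsto\vec d\}},$$ and otherwise it is $\top$. An infinite run is locally accepting if for each $\psi\,\mathsf U\,\psi'\in\mathrm{cl}(\varphi)$ some state containing $\psi'$ or $\neg(\psi\,\mathsf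 U\,\psi')$ is visited infinitely often. A finite run is potentially locally accepting if it can be continued, over some infinite sequence of letters, to a locally accepting run. **Algorithm T** for $(\varphi,v)$ keeps a buffer of pairs (state, list of obligations), starting with all initial states and empty lists. On reading a letter $e=(\mathfrak A,\sigma)$, it replaces each pair $(q,\ell)$ by the pairs $(q',\ell')$ for all transitions $q\to q'$ under $e$, where $\ell'$ is $\ell$ extended by the obligation $\delta_\downarrow(q,e)$; it calls Algorithm M, as a submonitor, for $(\psi,v')$ for each $\mathcal A_{\psi,v'}$ in the new obligation; it sends $e$ to all submonitors in all obligations and replaces each automaton whose submonitor answers $\top$ or $\bot$ by that truth value; it deletes all pairs with an obligation equivalent to $\bot$; and it removes from the remaining lists all obligations equivalent to $\top$. If the buffer is then empty, it answers "no runs". In a variant, T in addition keeps only those pairs that correspond to potentially locally accepting runs. **Algorithm M** for $(\varphi,v)$ runs Algorithm T for $(\varphi,v)$ and for $(\neg\varphi,v)$ and forwards each letter to both. If the first one answers "no runs", it outputs $\bot$ and stops; otherwise, if the second one answers "no runs", it outputs $\top$ and stops; otherwise it outputs $?$ and waits for the next letter. $M_{\varphi,v}(\overline{\mathfrak A},u)$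 denotes the last output after successively reading the letters of the finite temporal structure $(\overline{\mathfrak A},u)$ (and $?$ if there are none). **Theorem.** In both variants of Algorithm T (the variant being the same for the monitor and all its submonitors), for every formula $\varphi$, every valuation $v$ and every finite temporal structure $(\overline{\mathfrak A},u)$: if $M_{\varphi,v}(\overline{\mathfrak A},u)=\top$, then $(\overline{\mathfrak A},u)$ is a good prefix of $\varphi$ under $v$; if $M_{\varphi,v}(\overline{\mathfrak A},u)=\bot$, then $(\overline{\mathfrak A},u)$ is a bad prefix of $\varphi$ under $v$. In particular, for a sentence $\varphi$, $M_\varphi(\overline{\mathfrak A},u)=\top$ implies that $(\overline{\mathfrak A},u)$ is a good prefix of $\varphi$, and $M_\varphi(\overline{\mathfrak A},u)=\bot$ implies that it is a bad prefix. -/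

import Mathlib

namespace LTLFO

/-! ### Signatures, terms, formulae -/

/-- A sorted first-order signature: finitely many sorts (at least one), function symbols,
`U`-operators and `I`-operators, each with an arity ranging over the sorts. -/
structure Signature where
  Srt : Type
  Fn : Type
  UOp : Type
  IOp : Type
  finite_srt : Finite Srt
  nonempty_srt : Nonempty Srt
  finite_fn : Finite Fn
  finite_uop : Finite UOp
  finite_iop : Finite IOp
  fnArity : Fn → ℕ
  fnArg : (f : Fn) → Fin (fnArity f) → Srt
  fnRes : Fn → Srt
  uArity : UOp → ℕ
  uArg : (p : UOp) → Fin (uArity p) → Srt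
  iArity : IOp → ℕ
  iArg : (r : IOp) → Fin (iArity r) → Srt

/-- Well-sorted terms. The variables of sort `τ` are the pairs `(τ, m)` with `m : ℕ`. -/
inductive Term (Γ : Signature) : Γ.Srt → Type
  | var (τ : Γ.Srt) (m : ℕ) : Term Γ τ
  | app (f : Γ.Fn) (t : (i : Fin (Γ.fnArity f)) → Term Γ (Γ.fnArg f i)) : Term Γ (Γ.fnRes f)

/-- Well-sorted formulae. In `all p x hx φ`, i.e. `∀ (x₁, …, xₙ) : p. φ`, the variable `xᵢ` is
`(τᵢ, x i)`, where `τᵢ` is the `i`-th sort in the arity of `p`; the `xᵢ` are pairwise distinct. -/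
inductive Formula (Γ : Signature) : Type
  | uop (p : Γ.UOp) (t : (i : Fin (Γ.uArity p)) → Term Γ (Γ.uArg p i)) : Formula Γ
  | iop (r : Γ.IOp) (t : (i : Fin (Γ.iArity r)) → Term Γ (Γ.iArg r i)) : Formula Γ
  | neg (φ : Formula Γ) : Formula Γ
  | conj (φ ψ : Formula Γ) : Formula Γ
  | next (φ : Formula Γ) : Formula Γ
  | untl (φ ψ : Formula Γ) : Formula Γ
  | all (p : Γ.UOp) (x : Fin (Γ.uArity p) → ℕ)
      (hx : Function.Injective fun i => (Γ.uArg p i, x i)) (φ : Formula Γ) : Formula Γ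

/-! ### First-order temporal structures and semantics -/

/-- The part of a first-order structure that all structures of a first-order temporal structure
share: the sub-domains of the sorts and the interpretation of the function symbols. Two structures
`𝔄`, `𝔄'` are related by `𝔄 ∼ 𝔄'` iff they are structures over the same frame. -/
structure Frame (Γ : Signature) where
  Dom : Γ.Srt → Type
  nonempty_dom : ∀ τ, Nonempty (Dom τ)
  countable_dom : ∀ τ, Countable (Dom τ)
  fn : (f : Γ.Fn) → ((i : Fin (Γ.fnArity f)) → Dom (Γ.fnArg f i)) → Dom (Γ.fnRes f)

/-- Actions `(p, d)`, where `p` is a `U`-operator and `d` a tuple that fits the arity of `p`. -/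
abbrev Action {Γ : Signature} (𝔉 : Frame Γ) : Type :=
  Σ p : Γ.UOp, (i : Fin (Γ.uArity p)) → 𝔉.Dom (Γ.uArg p i)

/-- An input letter `(𝔄, σ)`: a structure `𝔄` over the frame `𝔉`, given by its interpretation of
the `I`-operators, and an event `σ`, i.e. a finite set of actions. A first-order temporal structure
over `𝔉` is a finite (`List`) or infinite (`Stream'`) sequence of letters. -/
structure Letter {Γ : Signature} (𝔉 : Frame Γ) where
  rel : (r : Γ.IOp) → Set ((i : Fin (Γ.iArity r)) → 𝔉.Dom (Γ.iArg r i))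
  event : Finset (Action 𝔉)

/-- The (finite) interpretation `{d | (p, d) ∈ σ}` of the `U`-operator `p`. -/
noncomputable def Letter.tuples {Γ : Signature} {𝔉 : Frame Γ} (e : Letter 𝔉) (p : Γ.UOp) :
    Finset ((i : Fin (Γ.uArity p)) → 𝔉.Dom (Γ.uArg p i)) :=
  e.event.preimage (fun d => (⟨p, d⟩ : Action 𝔉)) fun a _ b _ h => by simpa using h

/-- Valuations of the variables. (For a sentence the choice of the valuation plays no role.) -/
abbrev Valuation {Γ : Signature} (𝔉 : Frame Γ) : Type := (τ : Γ.Srt) → ℕ → 𝔉.Dom τ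

open Classical in
/-- The valuation `v ∪ {x₁ ↦ d₁, …, xₙ ↦ dₙ}`; existing values of the `xᵢ` are overwritten. -/
noncomputable def Valuation.bind {Γ : Signature} {𝔉 : Frame Γ} (v : Valuation 𝔉) (p : Γ.UOp)
    (x : Fin (Γ.uArity p) → ℕ) (d : (i : Fin (Γ.uArity p)) → 𝔉.Dom (Γ.uArg p i)) :
    Valuation 𝔉 :=
  fun τ m => if h : ∃ i, Γ.uArg p i = τ ∧ x i = m then h.choose_spec.1 ▸ d h.choose else v τ m

/-- The value of a term. -/
def Term.eval {Γ : Signature} {𝔉 : Frame Γ} (v : Valuation 𝔉) :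
    {τ : Γ.Srt} → Term Γ τ → 𝔉.Dom τ
  | _, .var τ m => v τ m
  | _, .app f t => 𝔉.fn f fun i => (t i).eval v

/-- Satisfaction `(𝔄̅, w, v, i) ⊨ φ` over an infinite first-order temporal structure. -/
def Sat {Γ : Signature} {𝔉 : Frame Γ} (w : Stream' (Letter 𝔉)) :
    Formula Γ → Valuation 𝔉 → ℕ → Prop
  | .uop p t, v, i => (fun k => (t k).eval v) ∈ (w.get i).tuples p
  | .iop r t, v, i => (fun k => (t k).eval v) ∈ (w.get i).rel r
  | .neg φ, v, i => ¬ Sat w φ v i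
  | .conj φ ψ, v, i => Sat w φ v i ∧ Sat w ψ v i
  | .next φ, v, i => Sat w φ v (i + 1)
  | .untl φ ψ, v, i => ∃ k, i ≤ k ∧ Sat w ψ v k ∧ ∀ j, i ≤ j → j < k → Sat w φ v j
  | .all p x _ φ, v, i => ∀ d ∈ (w.get i).tuples p, Sat w φ (v.bind p x d) i

/-- The language of infinite models of `φ` under `v`, among the temporal structures over `𝔉`. -/
def language {Γ : Signature} {𝔉 : Frame Γ} (φ : Formula Γ) (v : Valuation 𝔉) :
    Set (Stream' (Letter 𝔉)) :=
  {w | Sat w φ v 0}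

/-- Good prefixes: every infinite continuation lies in `L`. -/
def good {A : Type} (L : Set (Stream' A)) : Set (List A) := {u | ∀ w : Stream' A, u ++ₛ w ∈ L}

/-- Bad prefixes: no infinite continuation lies in `L`. -/
def bad {A : Type} (L : Set (Stream' A)) : Set (List A) := {u | ∀ w : Stream' A, u ++ₛ w ∉ L}

/-! ### Positive Boolean formulae and spawning automata -/

/-- Positive Boolean formulae over `X`. -/
inductive PosBool (X : Type) : Type
  | top : PosBool X
  | bot : PosBool X
  | atom (x : X) : PosBool X
  | and (β γ : PosBool X) : PosBool X
  | or (β γ : PosBool X) : PosBool X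

namespace PosBool

/-- `Y ⊨ β`. -/
def SatBy {X : Type} (Y : Set X) : PosBool X → Prop
  | .top => True
  | .bot => False
  | .atom x => x ∈ Y
  | .and β γ => SatBy Y β ∧ SatBy Y γ
  | .or β γ => SatBy Y β ∨ SatBy Y γ

/-- `β` is equivalent to `⊤`. -/
def IsTop {X : Type} (β : PosBool X) : Prop := ∀ Y : Set X, SatBy Y β

/-- `β` is equivalent to `⊥`. -/
def IsBot {X : Type} (β : PosBool X) : Prop := ∀ Y : Set X, ¬ SatBy Y β

/-- Replacement of every atom by a formula. -/
def subst {X Z : Type} (f : X → PosBool Z) : PosBool X → PosBool Z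
  | .top => .top
  | .bot => .bot
  | .atom x => f x
  | .and β γ => .and (subst f β) (subst f γ)
  | .or β γ => .or (subst f β) (subst f γ)

/-- Finite conjunctions; the empty one is `⊤`. -/
noncomputable def bigAnd {ι X : Type} (s : Finset ι) (f : ι → PosBool X) : PosBool X :=
  (s.toList.map f).foldr .and .top

/-- Finite disjunctions; the empty one is `⊥`. -/
noncomputable def bigOr {ι X : Type} (s : Finset ι) (f : ι → PosBool X) : PosBool X :=
  (s.toList.map f).foldr .or .bot

end PosBool

/-- A spawning automaton of level `level` over the alphabet `A`. The automata of lower level which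
it spawns are referred to by names; `C l` is the type of the names of automata of level `< l`. -/
structure SpawningAutomaton (A : Type) (C : ℕ → Type) where
  level : ℕ
  State : Type
  finite_state : Finite State
  start : Set State
  step : State → A → Set State
  spawn : State → A → PosBool (C level)
  acc : Set (Set State)

/-- `ρ` is locally accepting: each set of the acceptance condition contains a state that is visited
infinitely often. -/
def SpawningAutomaton.LocallyAccepting {A : Type} {C : ℕ → Type} (𝒜 : SpawningAutomaton A C)
    (ρ : ℕ → 𝒜.State) : Prop :=
  ∀ F ∈ 𝒜.acc, ∃ q ∈ F, ∃ᶠ i in Filter.atTop, ρ i = q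

/-- A finite run that ends in state `q` is potentially locally accepting: it has a locally accepting
continuation over some infinite suffix of the input. (Local acceptance of a run does not depend on
its finite beginnings, so only the last state `q` of the finite run matters.) -/
def SpawningAutomaton.PotLocallyAccepting {A : Type} {C : ℕ → Type} (𝒜 : SpawningAutomaton A C)
    (q : 𝒜.State) : Prop :=
  ∃ (w : Stream' A) (ρ : ℕ → 𝒜.State),
    ρ 0 = q ∧ (∀ i, ρ (i + 1) ∈ 𝒜.step (ρ i) (w.get i)) ∧ 𝒜.LocallyAccepting ρ

/-! ### The spawning automaton of a formula -/

namespace Formula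

variable {Γ : Signature}

/-- Quantifier depth. -/
def depth : Formula Γ → ℕ
  | uop _ _ => 0
  | iop _ _ => 0
  | neg φ => depth φ
  | conj φ ψ => max (depth φ) (depth ψ)
  | next φ => depth φ
  | untl φ ψ => max (depth φ) (depth ψ)
  | all _ _ _ φ => 1 + depth φ

open Classical in
/-- Subformulae, where quantified subformulae are not decomposed any further. -/
noncomputable def subf : Formula Γ → Finset (Formula Γ)
  | uop p t => {uop p t}
  | iop r t => {iop r t}
  | neg φ => insert (neg φ) (subf φ)
  | conj φ ψ => insert (conj φ ψ) (subf φ ∪ subf ψ)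
  | next φ => insert (next φ) (subf φ)
  | untl φ ψ => insert (untl φ ψ) (subf φ ∪ subf ψ)
  | all p x hx φ => {all p x hx φ}

/-- The negation of `φ`, where, as is usual for closures, `¬¬φ` is identified with `φ`. -/
def negate : Formula Γ → Formula Γ
  | neg φ => φ
  | φ => neg φ

open Classical in
/-- The closure of `φ`: the smallest set that contains `subf φ` and is closed under negation. -/
noncomputable def cl (φ : Formula Γ) : Finset (Formula Γ) := (subf φ).image negate ∪ subf φ

/-- `q` is a complete subset of `cl φ`. -/
structure IsComplete (φ : Formula Γ) (q : Finset (Formula Γ)) : Prop where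
  subset : q ⊆ cl φ
  neg_iff : ∀ ψ ∈ cl φ, (ψ ∈ q ∨ negate ψ ∈ q) ∧ ¬ (ψ ∈ q ∧ negate ψ ∈ q)
  conj_iff : ∀ ψ ψ', conj ψ ψ' ∈ cl φ → (conj ψ ψ' ∈ q ↔ ψ ∈ q ∧ ψ' ∈ q)
  untl_mem : ∀ ψ ψ', untl ψ ψ' ∈ cl φ → untl ψ ψ' ∈ q → ψ' ∈ q ∨ ψ ∈ q
  untl_notMem : ∀ ψ ψ', untl ψ ψ' ∈ cl φ → untl ψ ψ' ∉ q → ψ' ∉ q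

/-- The states of the automaton of `φ`. -/
abbrev State (φ : Formula Γ) : Type := {q : Finset (Formula Γ) // IsComplete φ q}

theorem finite_state (φ : Formula Γ) : Finite (State φ) :=
  Set.Finite.subset (Finset.finite_toSet (cl φ).powerset)
    (fun _ hq => Finset.mem_coe.2 (Finset.mem_powerset.2 (IsComplete.subset hq)))

theorem depth_negate (φ : Formula Γ) : depth (negate φ) = depth φ := by
  cases φ <;> rfl

theorem depth_le_of_mem_subf {φ ψ : Formula Γ} (h : ψ ∈ subf φ) : depth ψ ≤ depth φ := by
  induction φ with
  | uop p t => simp_all [subf]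
  | iop r t => simp_all [subf]
  | neg φ ih =>
    simp only [subf, Finset.mem_insert] at h
    rcases h with rfl | h
    · exact le_rfl
    · exact ih h
  | conj φ φ' ih ih' =>
    simp only [subf, Finset.mem_insert, Finset.mem_union] at h
    rcases h with rfl | h | h
    · exact le_rfl
    · exact (ih h).trans (le_max_left _ _)
    · exact (ih' h).trans (le_max_right _ _)
  | next φ ih =>
    simp only [subf, Finset.mem_insert] at h
    rcases h with rfl | h
    · exact le_rfl
    · exact ih h
  | untl φ φ' ih ih' =>
    simp only [subf, Finset.mem_insert, Finset.mem_union] at h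
    rcases h with rfl | h | h
    · exact le_rfl
    · exact (ih h).trans (le_max_left _ _)
    · exact (ih' h).trans (le_max_right _ _)
  | all p x hx φ => simp_all [subf]

theorem depth_le_of_mem_cl {φ ψ : Formula Γ} (h : ψ ∈ cl φ) : depth ψ ≤ depth φ := by
  simp only [cl, Finset.mem_union, Finset.mem_image] at h
  rcases h with ⟨χ, hχ, rfl⟩ | h
  · exact (depth_negate χ).trans_le (depth_le_of_mem_subf hχ)
  · exact depth_le_of_mem_subf h

theorem State.depth_lt {φ : Formula Γ} (q : State φ) {p : Γ.UOp} {x : Fin (Γ.uArity p) → ℕ}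
    {hx : Function.Injective fun i => (Γ.uArg p i, x i)} {ψ : Formula Γ}
    (h : all p x hx ψ ∈ q.1) : depth ψ < depth φ := by
  have h1 := depth_le_of_mem_cl (q.2.subset h)
  simp only [depth] at h1
  omega

theorem State.depth_neg_lt {φ : Formula Γ} (q : State φ) {p : Γ.UOp}
    {x : Fin (Γ.uArity p) → ℕ} {hx : Function.Injective fun i => (Γ.uArg p i, x i)}
    {ψ : Formula Γ} (h : neg (all p x hx ψ) ∈ q.1) : depth (neg ψ) < depth φ := by
  have h1 := depth_le_of_mem_cl (q.2.subset h)
  simp only [depth] at h1 ⊢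
  omega

end Formula

/-- Names of the automata `𝒜_{ψ,v}` of level `< l`. -/
abbrev SubAut {Γ : Signature} (𝔉 : Frame Γ) (l : ℕ) : Type :=
  {c : Formula Γ × Valuation 𝔉 // c.1.depth < l}

/-- The transition function of `𝒜_{φ,v}`. -/
def step {Γ : Signature} {𝔉 : Frame Γ} (φ : Formula Γ) (v : Valuation 𝔉) (q : φ.State)
    (e : Letter 𝔉) : Set φ.State :=
  {q' |
    ((∀ p t, .uop p t ∈ q.1 → (fun k => (t k).eval v) ∈ e.tuples p) ∧
      (∀ p t, .neg (.uop p t) ∈ q.1 → (fun k => (t k).eval v) ∉ e.tuples p) ∧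
      (∀ r t, .iop r t ∈ q.1 → (fun k => (t k).eval v) ∈ e.rel r) ∧
      (∀ r t, .neg (.iop r t) ∈ q.1 → (fun k => (t k).eval v) ∉ e.rel r)) ∧
    (∀ ψ, .next ψ ∈ φ.cl → (.next ψ ∈ q.1 ↔ ψ ∈ q'.1)) ∧
    (∀ ψ ψ', .untl ψ ψ' ∈ φ.cl →
      (.untl ψ ψ' ∈ q.1 ↔ ψ' ∈ q.1 ∨ (ψ ∈ q.1 ∧ .untl ψ ψ' ∈ q'.1)))}

/-- The conjunct of the spawning function of `𝒜_{φ,v}` contributed by `χ ∈ q`: for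
`χ = ∀ x : p. ψ` the conjunction of all `𝒜_{ψ, v ∪ {x ↦ d}}` with `(p, d) ∈ σ`; for
`χ = ¬ ∀ x : p. ψ` the disjunction of all `𝒜_{¬ψ, v ∪ {x ↦ d}}` with `(p, d) ∈ σ`. -/
noncomputable def spawnPart {Γ : Signature} {𝔉 : Frame Γ} (φ : Formula Γ) (v : Valuation 𝔉)
    (q : φ.State) (e : Letter 𝔉) :
    (χ : {χ : Formula Γ // χ ∈ q.1}) → PosBool (SubAut 𝔉 φ.depth)
  | ⟨.all p x _ ψ, h⟩ =>
      PosBool.bigAnd (e.tuples p) fun d => .atom ⟨(ψ, v.bind p x d), q.depth_lt h⟩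
  | ⟨.neg (.all p x _ ψ), h⟩ =>
      PosBool.bigOr (e.tuples p) fun d => .atom ⟨(.neg ψ, v.bind p x d), q.depth_neg_lt h⟩
  | _ => .top

/-- The spawning function of `𝒜_{φ,v}`. -/
noncomputable def spawn {Γ : Signature} {𝔉 : Frame Γ} (φ : Formula Γ) (v : Valuation 𝔉)
    (q : φ.State) (e : Letter 𝔉) : PosBool (SubAut 𝔉 φ.depth) :=
  if 0 < φ.depth then PosBool.bigAnd q.1.attach (spawnPart φ v q e) else .top

/-- The spawning automaton `𝒜_{φ,v}`. -/
noncomputable abbrev automaton {Γ : Signature} {𝔉 : Frame Γ} (φ : Formula Γ) (v : Valuation 𝔉) :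
    SpawningAutomaton (Letter 𝔉) (SubAut 𝔉) where
  level := φ.depth
  State := φ.State
  finite_state := φ.finite_state
  start := {q | φ ∈ q.1}
  step := step φ v
  spawn := spawn φ v
  acc := {F | ∃ ψ ψ', .untl ψ ψ' ∈ φ.cl ∧
    F = {q : φ.State | ψ' ∈ q.1 ∨ .neg (.untl ψ ψ') ∈ q.1}}

/-! ### The monitor -/

/-- The verdicts `⊤`, `⊥` and `?`. -/
inductive Verdict : Type
  | top : Verdict
  | bot : Verdict
  | unknown : Verdict

/-- A submonitor: an instance of Algorithm M, called for an automaton `𝒜_{ψ,v'}` of level `< l`,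
together with the letters that it has been sent so far. -/
abbrev SubMonitor {Γ : Signature} (𝔉 : Frame Γ) (l : ℕ) : Type :=
  SubAut 𝔉 l × List (Letter 𝔉)

/-- Buffers of Algorithm T for the automaton `𝒜_{φ,v}`: sets of pairs that consist of a state and a
list of obligations, the newest first. The automata that occur in the obligations are represented
by their submonitors. -/
abbrev Buffer {Γ : Signature} (𝔉 : Frame Γ) (φ : Formula Γ) : Type :=
  Set (φ.State × List (PosBool (SubMonitor 𝔉 φ.depth)))

section TrackRuns

/- In this section `sub c h` is the last verdict of the submonitor for `c` after it has been sent the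
letters `h`. -/
variable {Γ : Signature} {𝔉 : Frame Γ} (prune : Bool) (φ : Formula Γ) (v : Valuation 𝔉)
  (sub : SubAut 𝔉 φ.depth → List (Letter 𝔉) → Verdict)

/-- The buffer before the first letter is read: all initial states, without obligations. -/
def startBuffer : Buffer 𝔉 φ := {b | b.1 ∈ (automaton φ v).start ∧ b.2 = []}

/-- Extension of the buffered runs by all transitions under the letter `e`, where the new obligation
is put in front and its submonitors are created. If `prune` is set, then only potentially locally
accepting runs are kept. -/
def extendBuffer (e : Letter 𝔉) (B : Buffer 𝔉 φ) : Buffer 𝔉 φ :=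
  {b | ∃ a ∈ B, b.1 ∈ (automaton φ v).step a.1 e ∧
    (prune = true → (automaton φ v).PotLocallyAccepting b.1) ∧
    b.2 = ((automaton φ v).spawn a.1 e).subst (fun c => .atom (c, [])) :: a.2}

/-- Send the letter `e` to all submonitors in an obligation and replace those that answer `⊤` or `⊥`
by their verdict. -/
def sendLetter (e : Letter 𝔉) (obl : PosBool (SubMonitor 𝔉 φ.depth)) :
    PosBool (SubMonitor 𝔉 φ.depth) :=
  obl.subst fun s =>
    match sub s.1 (s.2 ++ [e]) with
    | .top => .top
    | .bot => .bot
    | .unknown => .atom (s.1, s.2 ++ [e])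

open Classical in
/-- Algorithm T: the new content of the buffer after the letter `e` has been processed. After sending
`e` to the submonitors, the runs with a violated obligation are removed from the buffer, and the
obligations that are met are removed from the remaining runs. -/
noncomputable def trackRuns (B : Buffer 𝔉 φ) (e : Letter 𝔉) : Buffer 𝔉 φ :=
  {b | ∃ a ∈ extendBuffer prune φ v e B,
    (∀ obl ∈ a.2.map (sendLetter φ sub e), ¬ obl.IsBot) ∧
    b = (a.1, (a.2.map (sendLetter φ sub e)).filter fun obl => ¬ obl.IsTop)}

end TrackRuns

/-- The states of Algorithm M for `φ`: it is running, with the buffers of its two instances of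
Algorithm T, one for `φ` and one for `¬φ`; or it has returned after printing a verdict. -/
inductive MonitorState {Γ : Signature} (𝔉 : Frame Γ) (φ : Formula Γ) : Type
  | running (B : Buffer 𝔉 φ) (B' : Buffer 𝔉 (.neg φ)) : MonitorState 𝔉 φ
  | returned (r : Verdict) : MonitorState 𝔉 φ

open Classical in
/-- Algorithm M: one round, in which the letter `e` is forwarded to both instances of Algorithm T.
An instance answers "no runs" iff its buffer is empty after it has processed the letter. -/
noncomputable def monitorStep {Γ : Signature} {𝔉 : Frame Γ} (prune : Bool) (φ : Formula Γ)
    (v : Valuation 𝔉) (sub : SubAut 𝔉 φ.depth → List (Letter 𝔉) → Verdict) :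
    MonitorState 𝔉 φ → Letter 𝔉 → MonitorState 𝔉 φ
  | .returned r, _ => .returned r
  | .running B B', e =>
      if trackRuns prune φ v sub B e = ∅ then .returned .bot
      else if trackRuns prune (.neg φ) v sub B' e = ∅ then .returned .top
      else .running (trackRuns prune φ v sub B e) (trackRuns prune (.neg φ) v sub B' e)

/-- The verdict printed last; it is `?` while the algorithm is running. -/
def MonitorState.verdict {Γ : Signature} {𝔉 : Frame Γ} {φ : Formula Γ} :
    MonitorState 𝔉 φ → Verdict
  | .running _ _ => .unknown
  | .returned r => r

/-- `M_{φ,v}(𝔄̅, u)`: the verdict of Algorithm M for `φ` under `v` after successively reading the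
letters of the finite temporal structure `u`. The recursion is on the quantifier depth: submonitors
are instances of the same algorithm for formulae of smaller depth. With `prune = true`, Algorithm T
tracks only the potentially locally accepting runs; with `prune = false`, it tracks all runs. -/
noncomputable def monitor {Γ : Signature} {𝔉 : Frame Γ} (prune : Bool) (φ : Formula Γ)
    (v : Valuation 𝔉) (u : List (Letter 𝔉)) : Verdict :=
  (u.foldl (monitorStep prune φ v fun c h => monitor prune c.1.1 c.1.2 h)
    (.running (startBuffer φ v) (startBuffer (.neg φ) v))).verdict
termination_by φ.depth
decreasing_by exact c.2

end LTLFO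

/-! Suppose some continuation makes the whole input `w` satisfy `φ`. The closure formulae true at
each position form a state, and these states form a run starting in an initial state. This canonical
run is locally accepting, so it survives in both variants of Algorithm T (`canonicalState_mem_step`,
`potLocallyAccepting_canonicalState`). Each obligation it incurs is satisfied by the set of spawned
automata whose formulae are true on the remaining input (`satBy_spawn_canonicalState`).

Obligations are positive, so they stay satisfied as long as no true automaton is replaced by `⊥`
(`satBy_sendLetter`). That is the `⊥` half of soundness for the submonitors, available by induction
on depth. Hence the canonical run is never deleted (`TracksCanonical.trackRuns`), and "no runs"
rules out every continuation satisfying `φ`. The verdict `⊤` is the same argument for `¬φ`. Only the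
passage from models to runs is needed, not the converse; replacing an automaton by `⊤` never
invalidates a satisfied obligation. -/

namespace LTLFO

/-! ### Satisfaction -/

section Semantics

variable {Γ : Signature} {𝔉 : Frame Γ}

theorem sat_drop (w : Stream' (Letter 𝔉)) (k : ℕ) (φ : Formula Γ) :
    ∀ (v : Valuation 𝔉) (i : ℕ), Sat (w.drop k) φ v i ↔ Sat w φ v (k + i) := by
  have hget : ∀ i, (w.drop k).get i = w.get (k + i) := fun i => by
    simp [Stream'.get_drop]
  induction φ with
  | uop p t => intro v i; simp only [Sat, hget]
  | iop r t => intro v i; simp only [Sat, hget]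
  | neg φ ih => intro v i; simp only [Sat, ih]
  | conj φ ψ ih ih' => intro v i; simp only [Sat, ih, ih']
  | next φ ih => intro v i; simp only [Sat, ih, Nat.add_assoc]
  | untl φ ψ ih ih' =>
    intro v i
    simp only [Sat, ih, ih']
    constructor
    · rintro ⟨m, hm, h, h'⟩
      refine ⟨k + m, by omega, h, fun j hj hjm => ?_⟩
      have := h' (j - k) (by omega) (by omega)
      rwa [show k + (j - k) = j by omega] at this
    · rintro ⟨m, hm, h, h'⟩
      refine ⟨m - k, by omega, ?_, fun j hj hjm => h' _ (by omega) (by omega)⟩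
      rwa [show k + (m - k) = m by omega]
  | all p x hx φ ih => intro v i; simp only [Sat, ih, hget]

theorem sat_drop_zero (w : Stream' (Letter 𝔉)) (k : ℕ) (φ : Formula Γ) (v : Valuation 𝔉) :
    Sat (w.drop k) φ v 0 ↔ Sat w φ v k := sat_drop w k φ v 0

theorem sat_cons_succ (e : Letter 𝔉) (w : Stream' (Letter 𝔉)) (φ : Formula Γ) (v : Valuation 𝔉)
    (i : ℕ) : Sat (Stream'.cons e w) φ v (i + 1) ↔ Sat w φ v i := by
  have h := sat_drop (Stream'.cons e w) 1 φ v i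
  rw [Nat.add_comm 1 i] at h
  exact h.symm

theorem sat_negate (w : Stream' (Letter 𝔉)) (φ : Formula Γ) (v : Valuation 𝔉) (i : ℕ) :
    Sat w φ.negate v i ↔ ¬ Sat w φ v i := by
  cases φ <;> simp [Formula.negate, Sat]

/-- The expansion law, from which the `U`-conditions on states and on transitions both follow. -/
theorem sat_untl_iff (w : Stream' (Letter 𝔉)) (ψ ψ' : Formula Γ) (v : Valuation 𝔉) (i : ℕ) :
    Sat w (.untl ψ ψ') v i ↔
      Sat w ψ' v i ∨ (Sat w ψ v i ∧ Sat w (.untl ψ ψ') v (i + 1)) := by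
  simp only [Sat]
  constructor
  · rintro ⟨k, hk, h, h'⟩
    rcases hk.eq_or_lt with rfl | hlt
    · exact .inl h
    · exact .inr ⟨h' i le_rfl hlt, k, hlt, h, fun j hj hjk => h' j (by omega) hjk⟩
  · rintro (h | ⟨h0, k, hk, h, h'⟩)
    · exact ⟨i, le_rfl, h, fun j hj hji => absurd hj (by omega)⟩
    · refine ⟨k, by omega, h, fun j hj hjk => ?_⟩
      rcases hj.eq_or_lt with rfl | hlt
      · exact h0
      · exact h' j hlt hjk

end Semantics

/-! ### Positive Boolean formulae -/

namespace PosBool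

variable {X Z ι : Type}

/-- Without negation, satisfaction is monotone, so nothing is needed about atoms outside `Y`. -/
theorem SatBy.subst {f : X → PosBool Z} {Y : Set X} {W : Set Z}
    (hf : ∀ x ∈ Y, SatBy W (f x)) {β : PosBool X} (h : SatBy Y β) : SatBy W (β.subst f) := by
  induction β with
  | top => trivial
  | bot => exact h
  | atom x => exact hf x h
  | and β γ ih ih' => exact ⟨ih h.1, ih' h.2⟩
  | or β γ ih ih' => exact h.imp ih ih'

theorem satBy_bigAnd {s : Finset ι} {f : ι → PosBool X} {Y : Set X} :
    SatBy Y (bigAnd s f) ↔ ∀ i ∈ s, SatBy Y (f i) := by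
  have h : ∀ l : List ι, SatBy Y ((l.map f).foldr .and .top) ↔ ∀ i ∈ l, SatBy Y (f i) := by
    intro l
    induction l with
    | nil => simp [SatBy]
    | cons a l ih => simp [SatBy, ih]
  simpa [bigAnd] using h s.toList

theorem satBy_bigOr {s : Finset ι} {f : ι → PosBool X} {Y : Set X} :
    SatBy Y (bigOr s f) ↔ ∃ i ∈ s, SatBy Y (f i) := by
  have h : ∀ l : List ι, SatBy Y ((l.map f).foldr .or .bot) ↔ ∃ i ∈ l, SatBy Y (f i) := by
    intro l
    induction l with
    | nil => simp [SatBy]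
    | cons a l ih => simp [SatBy, ih]
  simpa [bigOr] using h s.toList

end PosBool

/-! ### Closures -/

namespace Formula

variable {Γ : Signature}

theorem mem_subf_self (φ : Formula Γ) : φ ∈ subf φ := by
  cases φ <;> simp [subf]

open Classical in
theorem subf_subset_of_mem_subf {φ ψ : Formula Γ} (h : ψ ∈ subf φ) : subf ψ ⊆ subf φ := by
  induction φ with
  | uop p t => simp_all [subf]
  | iop r t => simp_all [subf]
  | all p x hx φ => simp_all [subf]
  | neg φ ih | next φ ih =>
    rw [subf, Finset.mem_insert] at h
    rcases h with rfl | h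
    · exact Finset.Subset.refl _
    · rw [subf]
      exact (ih h).trans (Finset.subset_insert _ _)
  | conj φ φ' ih ih' | untl φ φ' ih ih' =>
    rw [subf, Finset.mem_insert, Finset.mem_union] at h
    rcases h with rfl | h | h
    · exact Finset.Subset.refl _
    · rw [subf]
      exact (ih h).trans (Finset.subset_union_left.trans (Finset.subset_insert _ _))
    · rw [subf]
      exact (ih' h).trans (Finset.subset_union_right.trans (Finset.subset_insert _ _))

theorem mem_cl {φ ψ : Formula Γ} : ψ ∈ cl φ ↔ (∃ χ ∈ subf φ, negate χ = ψ) ∨ ψ ∈ subf φ := by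
  simp [cl]

theorem mem_cl_of_mem_subf {φ ψ : Formula Γ} (h : ψ ∈ subf φ) : ψ ∈ cl φ := mem_cl.2 (.inr h)

theorem mem_subf_of_neg_mem_subf {φ ψ : Formula Γ} (h : neg ψ ∈ subf φ) : ψ ∈ subf φ :=
  subf_subset_of_mem_subf h (by simp [subf, mem_subf_self])

/-- `negate` is not an involution: applied twice to `¬¬χ` it gives `χ`. This case relies on `subf`
containing the bodies of its negations. -/
theorem negate_mem_cl {φ ψ : Formula Γ} (h : ψ ∈ cl φ) : negate ψ ∈ cl φ := by
  rcases mem_cl.1 h with ⟨χ, hχ, rfl⟩ | h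
  · cases χ with
    | neg χ => exact mem_cl.2 (.inl ⟨χ, mem_subf_of_neg_mem_subf hχ, rfl⟩)
    | _ => exact mem_cl_of_mem_subf hχ
  · exact mem_cl.2 (.inl ⟨ψ, h, rfl⟩)

/-- Negating a subformula yields a non-negation only by stripping a `¬`, and the stripped body is
again a subformula. -/
theorem mem_subf_of_mem_cl {φ ψ : Formula Γ} (hψ : ∀ χ, ψ ≠ neg χ) (h : ψ ∈ cl φ) :
    ψ ∈ subf φ := by
  rcases mem_cl.1 h with ⟨χ, hχ, rfl⟩ | h
  · cases χ with
    | neg χ => exact mem_subf_of_neg_mem_subf hχ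
    | _ => exact absurd rfl (hψ _)
  · exact h

theorem mem_cl_of_conj_mem_cl {φ ψ ψ' : Formula Γ} (h : conj ψ ψ' ∈ cl φ) :
    ψ ∈ cl φ ∧ ψ' ∈ cl φ := by
  have hs := subf_subset_of_mem_subf (mem_subf_of_mem_cl (by simp) h)
  exact ⟨mem_cl_of_mem_subf (hs (by simp [subf, mem_subf_self])),
    mem_cl_of_mem_subf (hs (by simp [subf, mem_subf_self]))⟩

theorem mem_cl_of_untl_mem_cl {φ ψ ψ' : Formula Γ} (h : untl ψ ψ' ∈ cl φ) :
    ψ ∈ cl φ ∧ ψ' ∈ cl φ := by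
  have hs := subf_subset_of_mem_subf (mem_subf_of_mem_cl (by simp) h)
  exact ⟨mem_cl_of_mem_subf (hs (by simp [subf, mem_subf_self])),
    mem_cl_of_mem_subf (hs (by simp [subf, mem_subf_self]))⟩

theorem mem_cl_of_next_mem_cl {φ ψ : Formula Γ} (h : next ψ ∈ cl φ) : ψ ∈ cl φ :=
  mem_cl_of_mem_subf (subf_subset_of_mem_subf (mem_subf_of_mem_cl (by simp) h)
    (by simp [subf, mem_subf_self]))

end Formula

/-! ### The canonical run over a temporal structure -/

section Canonical

variable {Γ : Signature} {𝔉 : Frame Γ}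

open Classical in
theorem isComplete_filter_sat (φ : Formula Γ) (v : Valuation 𝔉) (w : Stream' (Letter 𝔉)) :
    Formula.IsComplete φ (φ.cl.filter fun ψ => Sat w ψ v 0) where
  subset := Finset.filter_subset _ _
  neg_iff ψ hψ := by
    simp only [Finset.mem_filter, hψ, Formula.negate_mem_cl hψ, true_and, sat_negate]
    tauto
  conj_iff ψ ψ' h := by
    obtain ⟨h1, h2⟩ := Formula.mem_cl_of_conj_mem_cl h
    simp only [Finset.mem_filter, h, h1, h2, true_and, Sat]
  untl_mem ψ ψ' h := by
    obtain ⟨h1, h2⟩ := Formula.mem_cl_of_untl_mem_cl h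
    simp only [Finset.mem_filter, h, h1, h2, true_and]
    rw [sat_untl_iff]
    tauto
  untl_notMem ψ ψ' h := by
    obtain ⟨h1, h2⟩ := Formula.mem_cl_of_untl_mem_cl h
    simp only [Finset.mem_filter, h, h2, true_and]
    rw [sat_untl_iff]
    tauto

open Classical in
/-- The state of `𝒜_{φ,v}` that consists of the formulae in the closure that hold initially. -/
noncomputable def canonicalState (φ : Formula Γ) (v : Valuation 𝔉) (w : Stream' (Letter 𝔉)) :
    φ.State :=
  ⟨φ.cl.filter fun ψ => Sat w ψ v 0, isComplete_filter_sat φ v w⟩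

theorem mem_canonicalState {φ ψ : Formula Γ} {v : Valuation 𝔉} {w : Stream' (Letter 𝔉)} :
    ψ ∈ (canonicalState φ v w).1 ↔ ψ ∈ φ.cl ∧ Sat w ψ v 0 := by
  simp [canonicalState]

/-- Literals at position 0 are evaluated in `e`, and position 1 of the longer stream is position 0
of `w`; the `U`-condition is then the expansion law. -/
theorem canonicalState_mem_step (φ : Formula Γ) (v : Valuation 𝔉) (e : Letter 𝔉)
    (w : Stream' (Letter 𝔉)) :
    canonicalState φ v w ∈ step φ v (canonicalState φ v (Stream'.cons e w)) e := by
  refine ⟨⟨?_, ?_, ?_, ?_⟩, ?_, ?_⟩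
  · intro p t h
    exact (mem_canonicalState.1 h).2
  · intro p t h
    exact (mem_canonicalState.1 h).2
  · intro r t h
    exact (mem_canonicalState.1 h).2
  · intro r t h
    exact (mem_canonicalState.1 h).2
  · intro ψ h
    simp only [mem_canonicalState, h, Formula.mem_cl_of_next_mem_cl h, true_and, Sat,
      sat_cons_succ]
  · intro ψ ψ' h
    obtain ⟨h1, h2⟩ := Formula.mem_cl_of_untl_mem_cl h
    simp only [mem_canonicalState, h, h1, h2, true_and]
    rw [sat_untl_iff, sat_cons_succ]

/-- The witnessing run consists of the canonical states of the suffixes of `w` itself. -/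
theorem potLocallyAccepting_canonicalState (φ : Formula Γ) (v : Valuation 𝔉)
    (w : Stream' (Letter 𝔉)) :
    (automaton φ v).PotLocallyAccepting (canonicalState φ v w) := by
  refine ⟨w, fun i => canonicalState φ v (w.drop i), rfl, fun i => ?_, ?_⟩
  · have h : w.drop i = Stream'.cons (w.get i) (w.drop (i + 1)) := by
      rw [← Stream'.eta (w.drop i), Stream'.tail_drop', Stream'.head_drop]
    change _ ∈ step φ v (canonicalState φ v (w.drop i)) (w.get i)
    rw [h]
    exact canonicalState_mem_step φ v _ _
  · rintro F ⟨ψ, ψ', hcl, rfl⟩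
    have : Finite φ.State := φ.finite_state
    obtain ⟨-, hcl'⟩ := Formula.mem_cl_of_untl_mem_cl hcl
    have hfreq : ∃ᶠ i in Filter.atTop, canonicalState φ v (w.drop i) ∈
        {q : φ.State | ψ' ∈ q.1 ∨ .neg (.untl ψ ψ') ∈ q.1} := by
      rw [Filter.frequently_atTop]
      intro n
      -- A true until is fulfilled at some `k ≥ n`; a false one puts its negation into the state at
      -- `n`.
      by_cases hu : Sat w (.untl ψ ψ') v n
      · obtain ⟨k, hk, h, -⟩ := hu
        exact ⟨k, hk, .inl (mem_canonicalState.2 ⟨hcl', (sat_drop_zero ..).2 h⟩)⟩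
      · refine ⟨n, le_rfl, .inr (mem_canonicalState.2 ⟨Formula.negate_mem_cl hcl, ?_⟩)⟩
        exact (sat_drop_zero ..).2 hu
    -- Acceptance asks for one recurring state, not just recurring visits to the set: since there
    -- are finitely many states, "each state is eventually avoided" becomes "eventually all are
    -- avoided".
    by_contra! hcon
    refine hfreq ?_
    have hev : ∀ᶠ i in Filter.atTop, ∀ q ∈ {q : φ.State | ψ' ∈ q.1 ∨ .neg (.untl ψ ψ') ∈ q.1},
        canonicalState φ v (w.drop i) ≠ q := by
      rw [Filter.eventually_all_finite (Set.toFinite _)]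
      intro q hq
      simpa [Filter.not_frequently] using hcon q hq
    filter_upwards [hev] with i hi hmem
    exact hi _ hmem rfl

theorem satBy_spawn_canonicalState (φ : Formula Γ) (v : Valuation 𝔉) (e : Letter 𝔉)
    (w : Stream' (Letter 𝔉)) :
    PosBool.SatBy {c : SubAut 𝔉 φ.depth | Sat (Stream'.cons e w) c.1.1 c.1.2 0}
      (spawn φ v (canonicalState φ v (Stream'.cons e w)) e) := by
  unfold spawn
  split_ifs
  · rw [PosBool.satBy_bigAnd]
    intro χ _
    have hsat := (mem_canonicalState.1 χ.2).2
    unfold spawnPart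
    split
    · rw [PosBool.satBy_bigAnd]
      exact fun d hd => hsat d hd
    -- An action on which the quantified formula fails selects the true disjunct.
    · rw [PosBool.satBy_bigOr]
      simp only [Sat, not_forall] at hsat
      obtain ⟨d, hd, h⟩ := hsat
      exact ⟨d, hd, h⟩
    · trivial
  · trivial

end Canonical

/-! ### Soundness of the monitor -/

section Soundness

variable {Γ : Signature} {𝔉 : Frame Γ}

/-- The submonitors whose formulae are satisfied by the letters that they have been sent, followed
by `w`. -/
def trueSubMonitors (l : ℕ) (w : Stream' (Letter 𝔉)) : Set (SubMonitor 𝔉 l) :=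
  {s | Sat (s.2 ++ₛ w) s.1.1.1 s.1.1.2 0}

/-- The buffer contains the canonical state for the remaining input `w`, with obligations that are
all satisfied when the input continues with `w`. -/
def TracksCanonical (φ : Formula Γ) (v : Valuation 𝔉) (B : Buffer 𝔉 φ)
    (w : Stream' (Letter 𝔉)) : Prop :=
  ∃ ℓ, (canonicalState φ v w, ℓ) ∈ B ∧
    ∀ obl ∈ ℓ, PosBool.SatBy (trueSubMonitors φ.depth w) obl

theorem tracksCanonical_startBuffer {φ : Formula Γ} {v : Valuation 𝔉} {w : Stream' (Letter 𝔉)}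
    (h : Sat w φ v 0) : TracksCanonical φ v (startBuffer φ v) w :=
  ⟨[], ⟨mem_canonicalState.2 ⟨Formula.mem_cl_of_mem_subf φ.mem_subf_self, h⟩, rfl⟩, by simp⟩

/-- Sending `e` moves it from the continuation to the history, so a true submonitor stays true. It
cannot answer `⊥`, and any other answer preserves satisfaction. -/
theorem satBy_sendLetter {φ : Formula Γ}
    {sub : SubAut 𝔉 φ.depth → List (Letter 𝔉) → Verdict}
    (hsub : ∀ c h, sub c h = .bot → h ∈ bad (language c.1.1 c.1.2)) {e : Letter 𝔉}
    {w : Stream' (Letter 𝔉)} {obl : PosBool (SubMonitor 𝔉 φ.depth)}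
    (h : PosBool.SatBy (trueSubMonitors φ.depth (Stream'.cons e w)) obl) :
    PosBool.SatBy (trueSubMonitors φ.depth w) (sendLetter φ sub e obl) := by
  refine PosBool.SatBy.subst (fun s hs => ?_) h
  have hs' : Sat ((s.2 ++ [e]) ++ₛ w) s.1.1.1 s.1.1.2 0 := by
    rw [Stream'.append_append_stream]
    exact hs
  split
  · trivial
  · next hv => exact hsub _ _ hv w hs'
  · exact hs'

/-- The invariant of a round: a satisfied obligation is not equivalent to `⊥`, so the pair is kept,
and dropping obligations is harmless. -/
theorem TracksCanonical.trackRuns {φ : Formula Γ} {v : Valuation 𝔉} (prune : Bool)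
    {sub : SubAut 𝔉 φ.depth → List (Letter 𝔉) → Verdict}
    (hsub : ∀ c h, sub c h = .bot → h ∈ bad (language c.1.1 c.1.2)) {e : Letter 𝔉}
    {w : Stream' (Letter 𝔉)} {B : Buffer 𝔉 φ} (h : TracksCanonical φ v B (Stream'.cons e w)) :
    TracksCanonical φ v (trackRuns prune φ v sub B e) w := by
  obtain ⟨ℓ, hB, hℓ⟩ := h
  set new : PosBool (SubMonitor 𝔉 φ.depth) :=
    (spawn φ v (canonicalState φ v (Stream'.cons e w)) e).subst (fun c => .atom (c, [])) with hnew
  have hsat : ∀ obl ∈ (new :: ℓ).map (sendLetter φ sub e),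
      PosBool.SatBy (trueSubMonitors φ.depth w) obl := by
    intro obl hobl
    obtain ⟨o, ho, rfl⟩ := List.mem_map.1 hobl
    refine satBy_sendLetter hsub ?_
    rcases List.mem_cons.1 ho with rfl | ho
    -- A fresh submonitor has empty history, so its truth is that of its formula on the stream
    -- starting with `e`.
    · exact PosBool.SatBy.subst (fun c hc => hc) (satBy_spawn_canonicalState φ v e w)
    · exact hℓ o ho
  exact ⟨_, ⟨(canonicalState φ v w, new :: ℓ),
      ⟨_, hB, canonicalState_mem_step φ v e w,
        fun _ => potLocallyAccepting_canonicalState φ v w, rfl⟩,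
      fun obl hobl hbot => hbot _ (hsat obl hobl), rfl⟩,
    fun obl hobl => hsat obl (List.mem_filter.1 hobl).1⟩

theorem foldl_monitorStep_returned (prune : Bool) (φ : Formula Γ) (v : Valuation 𝔉)
    (sub : SubAut 𝔉 φ.depth → List (Letter 𝔉) → Verdict) (r : Verdict) (u : List (Letter 𝔉)) :
    u.foldl (monitorStep prune φ v sub) (.returned r) = .returned r := by
  induction u with
  | nil => rfl
  | cons e u ih => exact ih

theorem TracksCanonical.ne_empty {φ : Formula Γ} {v : Valuation 𝔉} {w : Stream' (Letter 𝔉)}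
    {B : Buffer 𝔉 φ} (h : TracksCanonical φ v B w) : B ≠ ∅ := by
  obtain ⟨ℓ, hB, -⟩ := h
  exact Set.nonempty_iff_ne_empty.1 ⟨_, hB⟩

theorem not_tracksCanonical_of_verdict (prune : Bool) {φ : Formula Γ} {v : Valuation 𝔉}
    {sub : SubAut 𝔉 φ.depth → List (Letter 𝔉) → Verdict}
    (hsub : ∀ c h, sub c h = .bot → h ∈ bad (language c.1.1 c.1.2)) (w : Stream' (Letter 𝔉))
    (u : List (Letter 𝔉)) (B : Buffer 𝔉 φ) (B' : Buffer 𝔉 (.neg φ)) :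
    ((u.foldl (monitorStep prune φ v sub) (.running B B')).verdict = .bot →
      ¬ TracksCanonical φ v B (u ++ₛ w)) ∧
    ((u.foldl (monitorStep prune φ v sub) (.running B B')).verdict = .top →
      ¬ TracksCanonical (.neg φ) v B' (u ++ₛ w)) := by
  induction u generalizing B B' with
  -- A running monitor shows `?`, so both implications are vacuous.
  | nil => simp [MonitorState.verdict]
  | cons e u ih =>
    rw [List.foldl_cons, Stream'.cons_append_stream]
    by_cases h1 : LTLFO.trackRuns prune φ v sub B e = ∅
    · rw [monitorStep, if_pos h1, foldl_monitorStep_returned]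
      exact ⟨fun _ h => (h.trackRuns prune hsub).ne_empty h1, fun h => by cases h⟩
    · by_cases h2 : LTLFO.trackRuns prune (.neg φ) v sub B' e = ∅
      · rw [monitorStep, if_neg h1, if_pos h2, foldl_monitorStep_returned]
        exact ⟨fun h => (by cases h), fun _ h =>
          -- The same `sub` serves `¬φ`, because negation leaves the depth unchanged definitionally.
          (TracksCanonical.trackRuns (φ := .neg φ) prune hsub h).ne_empty h2⟩
      · rw [monitorStep, if_neg h1, if_neg h2]
        obtain ⟨ih1, ih2⟩ := ih (LTLFO.trackRuns prune φ v sub B e)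
          (LTLFO.trackRuns prune (.neg φ) v sub B' e)
        exact ⟨fun hv h => ih1 hv (h.trackRuns prune hsub), fun hv h =>
          ih2 hv (TracksCanonical.trackRuns (φ := .neg φ) prune hsub h)⟩

theorem monitor_sound (prune : Bool) (φ : Formula Γ) (v : Valuation 𝔉) (u : List (Letter 𝔉)) :
    (monitor prune φ v u = .top → u ∈ good (language φ v)) ∧
    (monitor prune φ v u = .bot → u ∈ bad (language φ v)) := by
  induction hn : φ.depth using Nat.strong_induction_on generalizing φ v u with
  | _ n ih =>
    subst hn
    have key := fun w => not_tracksCanonical_of_verdict (φ := φ) (v := v) prune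
      (sub := fun c h => monitor prune c.1.1 c.1.2 h)
      -- Only the `⊥` half of the induction hypothesis is used.
      (fun c h => (ih _ c.2 c.1.1 c.1.2 h rfl).2) w u (startBuffer φ v) (startBuffer (.neg φ) v)
    rw [monitor]
    refine ⟨fun hv w => ?_, fun hv w hw => (key w).1 hv (tracksCanonical_startBuffer hw)⟩
    -- A continuation violating `φ` satisfies `¬φ`, so the second instance would track its canonical
    -- run.
    by_contra hw
    exact (key w).2 hv (tracksCanonical_startBuffer hw)

end Soundness

end LTLFO

theorem mainTheorem3 (Γ : LTLFO.Signature) (𝔉 : LTLFO.Frame Γ) (prune : Bool)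
    (φ : LTLFO.Formula Γ) (v : LTLFO.Valuation 𝔉) (u : List (LTLFO.Letter 𝔉)) :
    (LTLFO.monitor prune φ v u = .top → u ∈ LTLFO.good (LTLFO.language φ v)) ∧
    (LTLFO.monitor prune φ v u = .bot → u ∈ LTLFO.bad (LTLFO.language φ v)) :=
  LTLFO.monitor_sound prune φ v u
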